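/- Let $K/k$ be a cyclic extension of number fields (that is, a finite Galois extension with cyclic Galois group) which is unramified at all finite places (every nonzero prime ideal of the ring of integers $\mathcal{O}_K$ is unramified over $\mathcal{O}_k$) and in which all infinite places of $k$ split completely (above each infinite place of $k$ there are exactly $[K:k]$ infinite places of $K$). Let $j_{K/k}\colon Cl_k\to Cl_K$ be the homomorphism of ideal class groups induced by extension of ideals, $\mathfrak{a}\mapsto \mathfrak{a}\mathcal{O}_K$, and let $Cap_{K/k}=\ker j_{K/k}$ be the capitulation kernel. Then the order of $Cap_{K/k}$ is a multiple of the degree: $[K:k]$ divides $|Cap_{K/k}|$. -/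

import Mathlib

open scoped NumberField

/-- The extension `K / k` is unramified at all finite places: every nonzero prime ideal of `𝓞 K`
is unramified over `𝓞 k`. -/
def IsUnramifiedAtFinitePlaces (k K : Type*) [Field k] [Field K] [Algebra k K] : Prop :=
  ∀ (P : Ideal (𝓞 K)) [P.IsPrime], P ≠ ⊥ → Algebra.IsUnramifiedAt (𝓞 k) P

/-- All infinite places of `k` split completely in `K`: above each infinite place of `k` there are
exactly `[K : k]` infinite places of `K`. -/
def InfinitePlacesSplitCompletely (k K : Type*) [Field k] [Field K] [Algebra k K] : Prop :=
  ∀ v : NumberField.InfinitePlace k,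
    Nat.card {w : NumberField.InfinitePlace K // w.comap (algebraMap k K) = v} =
      Module.finrank k K

/-- The capitulation kernel of `K / k`: the kernel of the homomorphism from the class group of `k`
to the class group of `K` induced by extension of ideals. -/
noncomputable def capitulationKernel (k K : Type*) [Field k] [NumberField k] [Field K]
    [NumberField K] [Algebra k K] : Subgroup (ClassGroup (𝓞 k)) :=
  (ClassGroup.extendedHom (𝓞 k) (𝓞 K)).ker

/-! Let `E` be the units of `𝓞 K`, `σ` a generator of the Galois group, `n = [K : k]`. Take pairs
`(a, J)`, `J` a fractional ideal of `k` whose extension to `K` is generated by `a`. The class of `J`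
capitulates. If `J = (b)`, then `a = v * b` with `v` a unit, so `σ a / a = σ v / v`. Conversely,
every unit of norm one is some `σ a / a`: Hilbert 90 supplies `a` with Galois-invariant ideal, and
in an unramified extension such an ideal comes from `k`
(`IsUnramifiedAtFinitePlaces.mem_range_toDiff`). So the index of `(σ - 1)E` in the kernel of the
norm divides the order of the capitulation kernel.

That `n` divides this index is a Herbrand quotient computation (`units_relIndex_eq`). The infinite
places of `K` form `r` free Galois orbits, so `E` contains with finite index a copy of `ℤ[G]^(r-1) ⊕
I_G`, `I_G` the augmentation ideal. This lattice has trivial Tate cohomology in degree 0 and order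
`n` in degree -1, and passing to finite index preserves the quotient. -/

section HerbrandQuotient

/-! ### Herbrand quotients and subgroups of finite index. -/

variable {A : Type*} [AddCommGroup A]

/-- The index of `B` is the product of the indices of its image and of its kernel part. -/
theorem AddSubgroup.relIndex_map_range_mul_relIndex_ker (f : A →+ A) (B : AddSubgroup A) :
    (B.map f).relIndex f.range * (f.ker ⊓ B).relIndex f.ker = B.index := by
  rw [AddMonoidHom.range_eq_map, AddSubgroup.relIndex_map_map, top_sup_eq,
    AddSubgroup.relIndex_top_right, inf_comm, AddSubgroup.inf_relIndex_right,
    ← AddSubgroup.relIndex_sup_right (K := B) (H := f.ker), sup_comm, mul_comm]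
  exact AddSubgroup.relIndex_mul_index le_sup_right

/-- The Herbrand quotient does not change on passing to a stable subgroup of finite index. -/
theorem AddSubgroup.relIndex_mul_relIndex_eq_of_index_ne_zero {f g : A →+ A}
    (hfg : ∀ x, f (g x) = 0) (hgf : ∀ x, g (f x) = 0) {B : AddSubgroup A}
    (hf : B.map f ≤ B) (hg : B.map g ≤ B) (hB : B.index ≠ 0) :
    g.range.relIndex f.ker * (B.map f).relIndex (g.ker ⊓ B) =
      f.range.relIndex g.ker * (B.map g).relIndex (f.ker ⊓ B) := by
  -- Both sides are the index of `g B` in `ker f`, computed through `g A` and through `ker f ⊓ B`.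
  have key : ∀ {f g : A →+ A}, (∀ x, f (g x) = 0) → B.map g ≤ B →
      (B.map g).relIndex g.range * g.range.relIndex f.ker =
        (B.map g).relIndex (f.ker ⊓ B) * (f.ker ⊓ B).relIndex f.ker := by
    intro f g h hg
    rw [AddSubgroup.relIndex_mul_relIndex, AddSubgroup.relIndex_mul_relIndex]
    · refine le_inf ?_ hg
      rintro _ ⟨x, -, rfl⟩
      exact h x
    · exact inf_le_left
    · exact AddSubgroup.map_le_range g B
    · rintro _ ⟨x, rfl⟩
      exact h x
  have h1 := key hfg hg
  have h2 := key hgf hf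
  have i1 := AddSubgroup.relIndex_map_range_mul_relIndex_ker f B
  have i2 := AddSubgroup.relIndex_map_range_mul_relIndex_ker g B
  have ne := hB
  rw [← i1] at ne
  have ne2 := hB
  rw [← i2] at ne2
  have n1 := left_ne_zero_of_mul ne
  have n2 := right_ne_zero_of_mul ne
  have n3 := left_ne_zero_of_mul ne2
  have i3 := i1.trans i2.symm
  -- The cancelled factors divide the finite index of `B`, hence are nonzero.
  apply mul_left_cancel₀ (mul_ne_zero n1 n3)
  generalize g.range.relIndex f.ker = a1 at *
  generalize f.range.relIndex g.ker = a0 at *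
  generalize (B.map f).relIndex f.range = p at *
  generalize (B.map g).relIndex g.range = q at *
  generalize (f.ker ⊓ B).relIndex f.ker = r at *
  generalize (g.ker ⊓ B).relIndex g.ker = t at *
  generalize (B.map g).relIndex (f.ker ⊓ B) = b1 at *
  generalize (B.map f).relIndex (g.ker ⊓ B) = b0 at *
  calc p * q * (a1 * b0) = p * b0 * (q * a1) := by ring
    _ = b0 * b1 * (p * r) := by rw [h1]; ring
    _ = q * b1 * (b0 * t) := by rw [i3]; ring
    _ = p * q * (a0 * b1) := by rw [← h2]; ring

end HerbrandQuotient

/-! ### Cohomology of free permutation modules of a cyclic group. -/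

section PermutationModule

variable {G : Type*} [Group G] {ι : Type*}

/-- Translation by `σ` minus the identity on the permutation module `ι × G → ℤ`. -/
def permDiff (ι : Type*) (σ : G) : (ι × G → ℤ) →+ (ι × G → ℤ) where
  toFun m x := m (x.1, σ⁻¹ * x.2) - m x
  map_zero' := by ext; simp
  map_add' m m' := by ext; simp only [Pi.add_apply]; ring

/-- The sum of the coordinates in the row `i`. -/
def rowSum (G : Type*) [Fintype G] (i : ι) : (ι × G → ℤ) →+ ℤ where
  toFun m := ∑ τ, m (i, τ)
  map_zero' := by simp
  map_add' m m' := by simp [Finset.sum_add_distrib]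

theorem permDiff_apply (σ : G) (m : ι × G → ℤ) (x : ι × G) :
    permDiff ι σ m x = m (x.1, σ⁻¹ * x.2) - m x := rfl

theorem rowSum_apply {G : Type*} [Fintype G] (i : ι) (m : ι × G → ℤ) : rowSum G i m = ∑ τ, m (i, τ) := rfl

theorem rowSum_permDiff [Fintype G] (σ : G) (i : ι) (m : ι × G → ℤ) : rowSum G i (permDiff ι σ m) = 0 := by
  simp only [rowSum_apply, permDiff_apply, Finset.sum_sub_distrib, sub_eq_zero]
  exact Fintype.sum_equiv (Equiv.mulLeft σ⁻¹) _ _ fun _ ↦ rfl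

theorem apply_eq_of_permDiff_eq_zero [Finite G] {σ : G} (hσ : ∀ τ, τ ∈ Subgroup.zpowers σ)
    {m : ι × G → ℤ} (hm : permDiff ι σ m = 0) (i : ι) (τ : G) : m (i, τ) = m (i, 1) := by
  have h : ∀ ρ, m (i, σ * ρ) = m (i, ρ) := fun ρ ↦ by
    have := congrFun hm (i, σ * ρ)
    simp only [permDiff_apply, inv_mul_cancel_left, Pi.zero_apply] at this
    linarith
  obtain ⟨j, rfl⟩ := mem_powers_iff_mem_zpowers.mpr (hσ τ)
  induction j with
  | zero => simp
  | succ j ih => simpa only [pow_succ', h] using ih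

variable [Fintype G] [DecidableEq G] [DecidableEq ι]

theorem exists_permDiff_eq [Fintype ι] {σ : G} (hσ : ∀ τ, τ ∈ Subgroup.zpowers σ)
    {m : ι × G → ℤ} (hm : ∀ i, rowSum G i m = 0) : ∃ m', permDiff ι σ m' = m := by
  -- Writing `τ = σ ^ j`, the difference telescopes along the powers of `σ`.
  have h1 : ∀ i τ, (Pi.single (i, τ) 1 - Pi.single (i, 1) 1 : ι × G → ℤ) ∈
      (permDiff ι σ).range := by
    intro i τ
    obtain ⟨j, rfl⟩ := mem_powers_iff_mem_zpowers.mpr (hσ τ)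
    induction j with
    | zero => simp
    | succ j ih =>
      have : (Pi.single (i, σ ^ (j + 1)) 1 - Pi.single (i, σ ^ j) 1 : ι × G → ℤ) ∈
          (permDiff ι σ).range := by
        refine ⟨Pi.single (i, σ ^ j) 1, ?_⟩
        ext ⟨i', τ⟩
        simp only [permDiff_apply, Pi.sub_apply, Pi.single_apply, Prod.mk.injEq, pow_succ',
          inv_mul_eq_iff_eq_mul]
      simpa using add_mem this ih
  have h2 : m = ∑ i, ∑ τ, m (i, τ) • (Pi.single (i, τ) 1 - Pi.single (i, 1) 1 : ι × G → ℤ) := by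
    simp only [smul_sub, Finset.sum_sub_distrib, ← Finset.sum_smul]
    simp only [← rowSum_apply, hm, zero_smul, Finset.sum_const_zero, sub_zero]
    rw [← Fintype.sum_prod_type' (f := fun i τ ↦ m (i, τ) • (Pi.single (i, τ) 1 : ι × G → ℤ))]
    ext x
    simp [Finset.sum_apply, Pi.single_apply]
  suffices m ∈ (permDiff ι σ).range from this
  rw [h2]
  exact sum_mem fun i _ ↦ sum_mem fun τ _ ↦ zsmul_mem (h1 i τ) _

end PermutationModule

/-! ### The Herbrand quotient of a module containing the permutation lattice. -/

section PermutationLattice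

variable {G : Type*} [Group G] [Fintype G] {ι : Type*} [Fintype ι]
  {A : Type*} [AddCommGroup A] [DistribMulAction G A]

/-- The equivariant map from the permutation module `ι × G → ℤ` sending the basis vector of
`(i, τ)` to `τ • η i`. -/
def permMap (G : Type*) [Group G] [Fintype G] [DistribMulAction G A] (η : ι → A) :
    (ι × G → ℤ) →+ A where
  toFun m := ∑ x, m x • (x.2 • η x.1)
  map_zero' := by simp
  map_add' m m' := by simp [add_smul, Finset.sum_add_distrib]

/-- The norm endomorphism `a ↦ ∑ τ, τ • a`. -/
def actionNorm (G A : Type*) [Group G] [Fintype G] [AddCommGroup A] [DistribMulAction G A] :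
    A →+ A where
  toFun a := ∑ τ : G, τ • a
  map_zero' := by simp
  map_add' a b := by simp [Finset.sum_add_distrib]

/-- The endomorphism `a ↦ σ • a - a`. -/
def actionDiff {G : Type*} (A : Type*) [Group G] [AddCommGroup A] [DistribMulAction G A] (σ : G) :
    A →+ A where
  toFun a := σ • a - a
  map_zero' := by simp
  map_add' a b := by rw [smul_add]; abel

theorem permMap_apply (η : ι → A) (m : ι × G → ℤ) :
    permMap G η m = ∑ x, m x • (x.2 • η x.1) := rfl

theorem actionNorm_apply (a : A) : actionNorm G A a = ∑ τ : G, τ • a := rfl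

theorem actionDiff_apply {G : Type*} [Group G] [DistribMulAction G A] (σ : G) (a : A) : actionDiff A σ a = σ • a - a := rfl

theorem actionNorm_actionDiff (σ : G) (a : A) : actionNorm G A (actionDiff A σ a) = 0 := by
  simp only [actionNorm_apply, actionDiff_apply, smul_sub, Finset.sum_sub_distrib, sub_eq_zero,
    ← mul_smul]
  exact Fintype.sum_equiv (Equiv.mulRight σ) _ _ fun _ ↦ rfl

theorem actionDiff_actionNorm (σ : G) (a : A) : actionDiff A σ (actionNorm G A a) = 0 := by
  simp only [actionNorm_apply, actionDiff_apply, Finset.smul_sum, sub_eq_zero, ← mul_smul]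
  exact Fintype.sum_equiv (Equiv.mulLeft σ) _ _ fun _ ↦ rfl

theorem permMap_permDiff (σ : G) (η : ι → A) (m : ι × G → ℤ) :
    permMap G η (permDiff ι σ m) = actionDiff A σ (permMap G η m) := by
  simp only [permMap_apply, permDiff_apply, actionDiff_apply, sub_smul, Finset.sum_sub_distrib,
    Finset.smul_sum, sub_left_inj]
  refine Fintype.sum_equiv (Equiv.prodCongr (Equiv.refl ι) (Equiv.mulLeft σ⁻¹)) _ _ fun x ↦ ?_
  simp [smul_comm σ, ← mul_smul, Prod.map]

theorem permMap_rowSum (η : ι → A) (m : ι × G → ℤ) :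
    permMap G η (fun x ↦ rowSum G x.1 m) = actionNorm G A (permMap G η m) := by
  simp only [permMap_apply, rowSum_apply, actionNorm_apply, Finset.smul_sum]
  rw [Fintype.sum_prod_type, Finset.sum_comm]
  simp only [Fintype.sum_prod_type, Finset.sum_smul]
  rw [Finset.sum_comm]
  conv_rhs => rw [Finset.sum_comm]
  refine Finset.sum_congr rfl fun i _ ↦ ?_
  rw [Finset.sum_comm]
  conv_rhs => rw [Finset.sum_comm]
  refine Finset.sum_congr rfl fun τ _ ↦ ?_
  refine Fintype.sum_equiv (Equiv.mulRight τ⁻¹) _ _ fun ρ ↦ ?_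
  simp only [Equiv.coe_mulRight]
  rw [smul_comm _ (m (i, τ)), ← mul_smul, inv_mul_cancel_right]

variable {σ : G} (hσ : ∀ τ, τ ∈ Subgroup.zpowers σ) {η : ι → A} {i₀ : ι}
  (hinj : ∀ m : ι × G → ℤ, permMap G η m = 0 → rowSum G i₀ m = 0 → m = 0)

include hσ hinj

/-- Vanishing of degree-0 Tate cohomology. An invariant `m` is constant on rows, so it is the norm
of the function carrying `m (i, 1)` at `(i, 1)`. On row `i₀` the constant has sum zero, hence is
zero, and the witness stays in the lattice. -/
theorem actionDiff_ker_inf_map_le :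
    (actionDiff A σ).ker ⊓ (rowSum G i₀).ker.map (permMap G η) ≤
      ((rowSum G i₀).ker.map (permMap G η)).map (actionNorm G A) := by
  classical
  rintro _ ⟨h, m, hm, rfl⟩
  have hd : permDiff ι σ m = 0 :=
    hinj _ ((permMap_permDiff σ η m).trans h) (rowSum_permDiff σ i₀ m)
  have hc := apply_eq_of_permDiff_eq_zero hσ hd
  have hm0 : m (i₀, 1) = 0 := by
    have : rowSum G i₀ m = 0 := hm
    simpa [rowSum_apply, hc i₀] using this
  have hs : ∀ i, rowSum G i (fun x : ι × G ↦ if x.2 = 1 then m (x.1, 1) else 0) = m (i, 1) := by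
    intro i
    simp [rowSum_apply]
  refine ⟨_, ⟨fun x ↦ if x.2 = 1 then m (x.1, 1) else 0, (hs i₀).trans hm0, rfl⟩, ?_⟩
  rw [← permMap_rowSum]
  congr 1
  ext x
  rw [hs, ← hc x.1 x.2]

/-- Degree -1. Norm zero forces all row sums to vanish, so the kernel of the norm is the image under
`h` of the full permutation module, while the smaller group is the image of the lattice. As `ker h`
consists of row-constant functions, whose row sums are multiples of `|G|`, the index is that of
`|G|ℤ` in `ℤ`. -/
theorem relIndex_actionDiff_map :
    (((rowSum G i₀).ker.map (permMap G η)).map (actionDiff A σ)).relIndex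
      ((actionNorm G A).ker ⊓ (rowSum G i₀).ker.map (permMap G η)) = Nat.card G := by
  classical
  set h := (permMap G η).comp (permDiff ι σ) with hh
  have e1 : (actionNorm G A).ker ⊓ (rowSum G i₀).ker.map (permMap G η) = (⊤ : AddSubgroup _).map h := by
    ext a
    constructor
    · rintro ⟨ha, m, hm, rfl⟩
      have h0 : (fun x : ι × G ↦ rowSum G x.1 m) = 0 := by
        refine hinj _ ((permMap_rowSum η m).trans ha) ?_
        have : rowSum G i₀ m = 0 := hm
        change ∑ τ : G, rowSum G i₀ m = 0
        simp [this]
      obtain ⟨m', rfl⟩ := exists_permDiff_eq hσ fun i ↦ congrFun h0 (i, 1)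
      exact ⟨m', trivial, rfl⟩
    · rintro ⟨m, -, rfl⟩
      refine ⟨?_, permDiff ι σ m, rowSum_permDiff σ i₀ m, rfl⟩
      change actionNorm G A (permMap G η (permDiff ι σ m)) = 0
      rw [permMap_permDiff, actionNorm_actionDiff]
  have e2 : ((rowSum G i₀).ker.map (permMap G η)).map (actionDiff A σ) = (rowSum G i₀).ker.map h := by
    rw [AddSubgroup.map_map]
    congr 1
    exact AddMonoidHom.ext fun m ↦ (permMap_permDiff σ η m).symm
  have e3 : (rowSum G i₀).ker ⊔ h.ker =
      (AddSubgroup.zmultiples (Nat.card G : ℤ)).comap (rowSum G i₀) := by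
    apply le_antisymm
    · rw [sup_le_iff]
      refine ⟨fun m hm ↦ ?_, fun m hm ↦ ?_⟩
      · have : rowSum G i₀ m = 0 := hm
        rw [AddSubgroup.mem_comap, this]
        exact zero_mem _
      · have hc := apply_eq_of_permDiff_eq_zero hσ (hinj _ hm (rowSum_permDiff σ i₀ m))
        rw [AddSubgroup.mem_comap, Int.mem_zmultiples_iff]
        exact ⟨m (i₀, 1), by simp [rowSum_apply, hc i₀]⟩
    · intro m hm
      rw [AddSubgroup.mem_comap, Int.mem_zmultiples_iff] at hm
      obtain ⟨c, hc⟩ := hm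
      have hconst : rowSum G i₀ (fun _ : ι × G ↦ c) = rowSum G i₀ m := by
        simp [hc, rowSum_apply]
      rw [← sub_add_cancel m (fun _ ↦ c)]
      refine AddSubgroup.add_mem_sup ?_ ?_
      · rw [AddMonoidHom.mem_ker, map_sub, hconst, sub_self]
      · change permMap G η (permDiff ι σ fun _ ↦ c) = 0
        have : permDiff ι σ (fun _ : ι × G ↦ c) = 0 := by ext; simp [permDiff_apply]
        rw [this, map_zero]
  rw [e1, e2, AddSubgroup.relIndex_map_map, top_sup_eq, AddSubgroup.relIndex_top_right, e3,
    AddSubgroup.index_comap_of_surjective, Int.index_zmultiples, Int.natAbs_natCast]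
  intro c
  exact ⟨Pi.single (i₀, 1) c, by simp [rowSum_apply, Pi.single_apply]⟩

/-- If the permutation lattice `{m | ∑ τ, m (i₀, τ) = 0}` embeds in `A` with finite index, then the
Herbrand quotient of `A` is `|G|`. -/
theorem relIndex_actionDiff_eq_card_mul
    (hfin : ((rowSum G i₀).ker.map (permMap G η)).index ≠ 0) :
    (actionDiff A σ).range.relIndex (actionNorm G A).ker =
      Nat.card G * (actionNorm G A).range.relIndex (actionDiff A σ).ker := by
  have h := AddSubgroup.relIndex_mul_relIndex_eq_of_index_ne_zero
    (actionNorm_actionDiff (A := A) σ) (actionDiff_actionNorm σ) ?_ ?_ hfin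
  · rwa [AddSubgroup.relIndex_eq_one.mpr (actionDiff_ker_inf_map_le hσ hinj),
      relIndex_actionDiff_map hσ hinj, mul_one, mul_comm _ (Nat.card G)] at h
  · rintro _ ⟨_, ⟨m, hm, rfl⟩, rfl⟩
    refine ⟨_, ?_, permMap_rowSum η m⟩
    have : rowSum G i₀ m = 0 := hm
    change ∑ τ : G, rowSum G i₀ m = 0
    simp [this]
  · rintro _ ⟨_, ⟨m, hm, rfl⟩, rfl⟩
    exact ⟨_, rowSum_permDiff σ i₀ m, permMap_permDiff σ η m⟩

-- The lattice embeds and has the rank of `A`, so the quotient is finitely generated and torsion,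
-- hence finite.
omit hσ in
theorem index_map_permMap_ne_zero [Module.Finite ℤ A]
    (hrank : Module.finrank ℤ A + 1 = Fintype.card ι * Fintype.card G) :
    ((rowSum G i₀).ker.map (permMap G η)).index ≠ 0 := by
  classical
  set S : (ι × G → ℤ) →ₗ[ℤ] ℤ := (rowSum G i₀).toIntLinearMap
  set Φ : (ι × G → ℤ) →ₗ[ℤ] A := (permMap G η).toIntLinearMap
  have hsurj : Function.Surjective S := fun c ↦
    ⟨Pi.single (i₀, 1) c, by simp [S, rowSum_apply, Pi.single_apply]⟩
  have h1 := (LinearMap.ker S).finrank_quotient_add_finrank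
  rw [(S.quotKerEquivOfSurjective hsurj).finrank_eq, Module.finrank_self,
    Module.finrank_fintype_fun_eq_card, Fintype.card_prod, ← hrank, add_comm, add_left_inj] at h1
  have hΦ : Function.Injective (Φ.domRestrict (LinearMap.ker S)) := by
    rw [← LinearMap.ker_eq_bot, LinearMap.ker_eq_bot']
    intro m hm
    exact Subtype.ext (hinj m.1 hm m.2)
  have h2 := LinearMap.finrank_range_of_inj hΦ
  have h3 := (LinearMap.range (Φ.domRestrict (LinearMap.ker S))).finrank_quotient_add_finrank
  rw [h2, h1] at h3
  have h4 : Module.finrank ℤ (A ⧸ LinearMap.range (Φ.domRestrict (LinearMap.ker S))) = 0 := by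
    omega
  have h5 : Finite (A ⧸ LinearMap.range (Φ.domRestrict (LinearMap.ker S))) :=
    Module.finite_of_fg_torsion _ (Module.finrank_eq_zero_iff_isTorsion.mp h4)
  have h6 : (LinearMap.range (Φ.domRestrict (LinearMap.ker S))).toAddSubgroup =
      (rowSum G i₀).ker.map (permMap G η) := by
    ext a
    constructor
    · rintro ⟨m, rfl⟩
      exact ⟨m.1, m.2, rfl⟩
    · rintro ⟨m, hm, rfl⟩
      exact ⟨⟨m, hm⟩, rfl⟩
  rw [← h6]
  have : Finite (A ⧸ (LinearMap.range (Φ.domRestrict (LinearMap.ker S))).toAddSubgroup) := h5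
  exact AddSubgroup.index_ne_zero_of_finite

end PermutationLattice

/-! ### Units with independent logarithms, and their Herbrand quotient. -/

open NumberField

/-- A real square matrix with negative off-diagonal entries and vanishing column sums has no
kernel vector with a positive and a non-positive coordinate. -/
theorem forall_pos_or_forall_nonpos_of_sum_mul_eq_zero {X : Type*} [Fintype X]
    {L : X → X → ℝ} (hneg : ∀ w x, w ≠ x → L w x < 0) (hsum : ∀ x, ∑ w, L w x = 0)
    {m : X → ℝ} (hm : ∀ w, ∑ x, L w x * m x = 0) : (∀ x, 0 < m x) ∨ ∀ x, m x ≤ 0 := by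
  classical
  by_contra! h
  obtain ⟨⟨x₀, hx₀⟩, y₀, hy₀⟩ := h
  -- Adding up the rows in `P` gives column sums that are positive on `P` and at most zero off it,
  -- so every term of the total has the right sign and the total cannot vanish.
  let P : Finset X := {x | 0 < m x}
  have h0 : ∑ x, (∑ w ∈ P, L w x) * m x = 0 := by
    simp only [Finset.sum_mul]
    rw [Finset.sum_comm]
    exact Finset.sum_eq_zero fun w _ ↦ hm w
  have hpos : ∀ x, 0 < m x → 0 < (∑ w ∈ P, L w x) * m x := by
    intro x hx
    refine mul_pos ?_ hx
    have h1 := hsum x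
    rw [← Finset.sum_add_sum_compl P] at h1
    have h2 : ∑ w ∈ Pᶜ, L w x < 0 := by
      refine Finset.sum_neg (fun w hw ↦ hneg w x ?_) ⟨x₀, by simpa [P] using hx₀⟩
      rintro rfl
      simp [P] at hw
      linarith
    linarith
  have hnonneg : ∀ x, m x ≤ 0 → 0 ≤ (∑ w ∈ P, L w x) * m x := by
    intro x hx
    refine mul_nonneg_of_nonpos_of_nonpos (Finset.sum_nonpos fun w hw ↦ (hneg w x ?_).le) hx
    rintro rfl
    simp [P] at hw
    linarith
  have : 0 < ∑ x, (∑ w ∈ P, L w x) * m x :=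
    Finset.sum_pos' (fun x _ ↦ (lt_or_ge 0 (m x)).elim (fun h ↦ (hpos x h).le) (hnonneg x))
      ⟨y₀, Finset.mem_univ _, hpos y₀ hy₀⟩
  exact this.ne' h0

section Units

variable {k K : Type*} [Field k] [NumberField k] [Field K] [NumberField K] [Algebra k K]

instance : FiniteDimensional k K := Module.Finite.of_restrictScalars_finite ℚ k K

/-- The action of the Galois group on the units of the ring of integers, written additively. -/
noncomputable instance : DistribMulAction Gal(K/k) (Additive (𝓞 K)ˣ) where
  smul σ u := Additive.ofMul
    (Units.map (galRestrict (𝓞 k) k K (𝓞 K) σ : 𝓞 K →* 𝓞 K) u.toMul)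
  one_smul u := by
    refine Additive.toMul.injective <| Units.ext ?_
    change galRestrict (𝓞 k) k K (𝓞 K) 1 (u.toMul : 𝓞 K) = _
    rw [map_one, AlgEquiv.one_apply]
  mul_smul σ τ u := by
    refine Additive.toMul.injective <| Units.ext ?_
    change galRestrict (𝓞 k) k K (𝓞 K) (σ * τ) (u.toMul : 𝓞 K) = _
    rw [map_mul, AlgEquiv.mul_apply]
    rfl
  smul_zero σ := Additive.toMul.injective <| map_one (Units.map _)
  smul_add σ u v := Additive.toMul.injective <| map_mul (Units.map _) u.toMul v.toMul

theorem coe_toMul_smul (σ : Gal(K/k)) (u : Additive (𝓞 K)ˣ) :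
    (((σ • u).toMul : 𝓞 K) : K) = σ ((u.toMul : 𝓞 K) : K) :=
  algebraMap_galRestrict_apply (𝓞 k) σ (u.toMul : 𝓞 K)

/-- When all infinite places split completely, the infinite places of `K` are a free `Gal(K/k)`-set
over the infinite places of `k`. -/
theorem InfinitePlacesSplitCompletely.bijective_smul [IsGalois k K]
    (h : InfinitePlacesSplitCompletely k K) {w : InfinitePlace k → InfinitePlace K}
    (hw : ∀ v, (w v).comap (algebraMap k K) = v) :
    Function.Bijective fun x : InfinitePlace k × Gal(K/k) ↦ x.2 • w x.1 := by
  have hcomap : ∀ (τ : Gal(K/k)) v, (τ • w v).comap (algebraMap k K) = v := fun τ v ↦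
    (InfinitePlace.mem_orbit_iff.mp ⟨τ, rfl⟩).symm.trans (hw v)
  have hsurj : Function.Surjective fun x : InfinitePlace k × Gal(K/k) ↦ x.2 • w x.1 := by
    intro w'
    obtain ⟨τ, hτ⟩ := InfinitePlace.exists_smul_eq_of_comap_eq
      (hw (w'.comap (algebraMap k K)))
    exact ⟨(_, τ), hτ⟩
  refine ⟨?_, hsurj⟩
  rintro ⟨v, τ⟩ ⟨v', τ'⟩ heq
  obtain rfl : v = v' := by rw [← hcomap τ v, ← hcomap τ' v']; exact congrArg (·.comap (algebraMap k K)) heq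
  let f : Gal(K/k) → {u : InfinitePlace K // u.comap (algebraMap k K) = v} :=
    fun τ ↦ ⟨τ • w v, hcomap τ v⟩
  have hf : Function.Surjective f := by
    rintro ⟨u, hu⟩
    obtain ⟨τ, hτ⟩ := InfinitePlace.exists_smul_eq_of_comap_eq ((hw v).trans hu.symm)
    exact ⟨τ, Subtype.ext hτ⟩
  -- A transitive action on a fibre with as many elements as the group is free.
  have hbij := hf.bijective_of_nat_card_le (by rw [h v, IsGalois.card_aut_eq_finrank])
  exact congrArg _ (hbij.1 (Subtype.ext heq))

/-- Choose `η v` of absolute value below 1 at every place but `w v`. The logarithms of its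
conjugates form a matrix with negative off-diagonal entries and, by the product formula, zero column
sums. A relation `m` is a kernel vector, as is `-m`; the zero sum on row `i₀` excludes both strict
signs, so `m = 0`. -/
theorem exists_units_permMap_injective [IsGalois k K] (h : InfinitePlacesSplitCompletely k K) :
    Fintype.card (InfinitePlace K) = Fintype.card (InfinitePlace k) * Fintype.card Gal(K/k) ∧
    ∃ η : InfinitePlace k → Additive (𝓞 K)ˣ, ∀ (i₀ : InfinitePlace k) m,
      permMap Gal(K/k) η m = 0 → rowSum Gal(K/k) i₀ m = 0 → m = 0 := by
  choose w hw using InfinitePlace.comap_surjective (k := k) (K := K)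
  have hbij := h.bijective_smul hw
  refine ⟨by rw [← Fintype.card_prod]; exact (Fintype.card_of_bijective hbij).symm, ?_⟩
  choose η hη using fun v ↦ Units.dirichletUnitTheorem.exists_unit K (w v)
  refine ⟨fun v ↦ Additive.ofMul (η v), fun i₀ m hm hrow ↦ ?_⟩
  let e : InfinitePlace k × Gal(K/k) → InfinitePlace K := fun x ↦ x.2 • w x.1
  let lg : InfinitePlace K → Additive (𝓞 K)ˣ →+ ℝ := fun v ↦
    { toFun u := v.mult * Real.log (v ((u.toMul : 𝓞 K) : K))
      map_zero' := by simp
      map_add' a b := by simp [Real.log_mul, mul_add] }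
  let L : InfinitePlace k × Gal(K/k) → InfinitePlace k × Gal(K/k) → ℝ := fun y x ↦
    lg (e y) (x.2 • Additive.ofMul (η x.1))
  have hneg : ∀ y x, y ≠ x → L y x < 0 := by
    intro y x hyx
    have h1 : x.2⁻¹ • e y ≠ w x.1 := fun h1 ↦ hyx (hbij.1 (inv_smul_eq_iff.mp h1))
    have h2 := hη x.1 _ h1
    change (_ : ℝ) * Real.log _ < 0
    rw [coe_toMul_smul]
    exact mul_neg_of_pos_of_neg (by exact_mod_cast InfinitePlace.mult_pos) h2
  have hsum : ∀ x, ∑ y, L y x = 0 := by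
    intro x
    rw [← Units.sum_mult_mul_log (x.2 • Additive.ofMul (η x.1)).toMul]
    exact Fintype.sum_bijective e hbij _ _ fun _ ↦ rfl
  have hker : ∀ y, ∑ x, L y x * (m x : ℝ) = 0 := by
    intro y
    have := congrArg (lg (e y)) hm
    rw [permMap_apply, map_sum, map_zero] at this
    rw [← this]
    refine Finset.sum_congr rfl fun x _ ↦ ?_
    rw [map_zsmul, zsmul_eq_mul, mul_comm]
  have hker' : ∀ y, ∑ x, L y x * (-m x : ℝ) = 0 := by
    intro y
    simpa using hker y
  have hrow' : ∑ τ, m (i₀, τ) = 0 := hrow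
  have hle : ∀ x, m x ≤ 0 := by
    rcases forall_pos_or_forall_nonpos_of_sum_mul_eq_zero hneg hsum hker with hp | hp
    · have : 0 < ∑ τ : Gal(K/k), m (i₀, τ) :=
        Finset.sum_pos (fun τ _ ↦ by exact_mod_cast hp (i₀, τ)) Finset.univ_nonempty
      exact absurd hrow' this.ne'
    · exact fun x ↦ by exact_mod_cast hp x
  have hge : ∀ x, 0 ≤ m x := by
    rcases forall_pos_or_forall_nonpos_of_sum_mul_eq_zero hneg hsum hker' with hp | hp
    · have : ∑ τ : Gal(K/k), m (i₀, τ) < 0 :=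
        Finset.sum_neg (fun τ _ ↦ by exact_mod_cast neg_pos.mp (hp (i₀, τ))) Finset.univ_nonempty
      exact absurd hrow' this.ne
    · exact fun x ↦ by exact_mod_cast neg_nonpos.mp (hp x)
  exact funext fun x ↦ le_antisymm (hle x) (hge x)

/-- The Herbrand quotient of the units when all infinite places split completely. -/
theorem units_relIndex_eq [IsGalois k K] (h : InfinitePlacesSplitCompletely k K)
    {σ : Gal(K/k)} (hσ : ∀ τ, τ ∈ Subgroup.zpowers σ) :
    (actionDiff (Additive (𝓞 K)ˣ) σ).range.relIndex
        (actionNorm Gal(K/k) (Additive (𝓞 K)ˣ)).ker =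
      Module.finrank k K * (actionNorm Gal(K/k) (Additive (𝓞 K)ˣ)).range.relIndex
        (actionDiff (Additive (𝓞 K)ˣ) σ).ker := by
  obtain ⟨hcard, η, hη⟩ := exists_units_permMap_injective h
  obtain ⟨i₀⟩ : Nonempty (InfinitePlace k) := inferInstance
  rw [← IsGalois.card_aut_eq_finrank]
  refine relIndex_actionDiff_eq_card_mul hσ (hη i₀) (index_map_permMap_ne_zero (hη i₀) ?_)
  rw [← hcard, Units.finrank_eq, Units.rank, Nat.sub_add_cancel Fintype.card_pos]

end Units

/-! ### Galois-invariant ideals in unramified extensions. -/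

section InvariantIdeals

variable {k K : Type*} [Field k] [NumberField k] [Field K] [NumberField K] [Algebra k K]

open UniqueFactorizationMonoid in
/-- In an extension unramified at the finite places, a nonzero prime of `𝓞 k` extends to a
squarefree ideal of `𝓞 K`. -/
theorem IsUnramifiedAtFinitePlaces.squarefree_map (h : IsUnramifiedAtFinitePlaces k K)
    {p : Ideal (𝓞 k)} [hp : p.IsPrime] (hp0 : p ≠ ⊥) :
    Squarefree (p.map (algebraMap (𝓞 k) (𝓞 K))) := by
  classical
  have hmap : p.map (algebraMap (𝓞 k) (𝓞 K)) ≠ ⊥ := Ideal.map_ne_bot_of_ne_bot hp0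
  rw [squarefree_iff_nodup_normalizedFactors hmap, Multiset.nodup_iff_count_le_one]
  intro P
  by_cases hP : P ∈ normalizedFactors (p.map (algebraMap (𝓞 k) (𝓞 K)))
  · have hprime := prime_of_normalized_factor P hP
    have hP0 : P ≠ ⊥ := hprime.ne_zero
    have : P.IsPrime := Ideal.isPrime_of_prime hprime
    have hle := Ideal.dvd_iff_le.mp (dvd_of_mem_normalizedFactors hP)
    have hmax : p.IsMaximal := hp.isMaximal hp0
    have hu : P.under (𝓞 k) = p :=
      (hmax.eq_of_le (Ideal.IsPrime.ne_top inferInstance) (Ideal.map_le_iff_le_comap.mp hle)).symm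
    have : P.LiesOver p := ⟨hu.symm⟩
    have := h P hP0
    rw [← Ideal.IsDedekindDomain.ramificationIdx'_eq_normalizedFactors_count hmap ‹_› hP0,
      Ideal.ramificationIdx'_eq_ramificationIdx' p P hmap, Ideal.ramificationIdx_eq_one]
  · rw [Multiset.count_eq_zero_of_notMem hP]
    exact zero_le_one

variable [IsGalois k K]

-- The primes above `Q.under (𝓞 k)` are conjugate to `Q`, so by invariance they all divide `I`;
-- being squarefree, the extended prime divides `I`.
open UniqueFactorizationMonoid in
theorem IsUnramifiedAtFinitePlaces.map_under_dvd (h : IsUnramifiedAtFinitePlaces k K)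
    {I : Ideal (𝓞 K)} (hI0 : I ≠ ⊥)
    (hI : ∀ σ : Gal(K/k), I.map (galRestrict (𝓞 k) k K (𝓞 K) σ) = I)
    {Q : Ideal (𝓞 K)} [Q.IsPrime] (hQ : I ≤ Q) :
    (Q.under (𝓞 k)).map (algebraMap (𝓞 k) (𝓞 K)) ∣ I := by
  classical
  have hQ0 : Q ≠ ⊥ := fun hQ0 ↦ hI0 (le_bot_iff.mp (hQ0 ▸ hQ))
  set p := Q.under (𝓞 k) with hpdef
  have hp0 : p ≠ ⊥ := Ideal.under_ne_bot (𝓞 k) hQ0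
  have hmap : p.map (algebraMap (𝓞 k) (𝓞 K)) ≠ ⊥ := Ideal.map_ne_bot_of_ne_bot hp0
  rw [dvd_iff_normalizedFactors_le_normalizedFactors hmap hI0, Multiset.le_iff_subset
    ((squarefree_iff_nodup_normalizedFactors hmap).mp (h.squarefree_map hp0))]
  intro P hP
  have hprime := prime_of_normalized_factor P hP
  have : P.IsPrime := Ideal.isPrime_of_prime hprime
  have hle := Ideal.dvd_iff_le.mp (dvd_of_mem_normalizedFactors hP)
  have hmax : p.IsMaximal := Ideal.IsPrime.isMaximal inferInstance hp0
  have hu : P.under (𝓞 k) = p :=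
    (hmax.eq_of_le (Ideal.IsPrime.ne_top inferInstance) (Ideal.map_le_iff_le_comap.mp hle)).symm
  obtain ⟨σ, rfl⟩ := Ideal.exists_comap_galRestrict_eq (𝓞 k) k K (𝓞 K) (p := p) (P₁ := Q)
    (P₂ := P) ⟨inferInstance, ⟨hpdef⟩⟩ ⟨inferInstance, ⟨hu.symm⟩⟩
  rw [mem_normalizedFactors_iff' hI0]
  refine ⟨hprime.irreducible, normalize_eq _, Ideal.dvd_iff_le.mpr ?_⟩
  rw [← Ideal.map_le_iff_le_comap, hI]
  exact hQ

/-- In an extension unramified at the finite places, Galois-invariant ideals are extended from the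
base. -/
theorem IsUnramifiedAtFinitePlaces.exists_map_eq (h : IsUnramifiedAtFinitePlaces k K)
    {I : Ideal (𝓞 K)} (hI0 : I ≠ ⊥)
    (hI : ∀ σ : Gal(K/k), I.map (galRestrict (𝓞 k) k K (𝓞 K) σ) = I) :
    ∃ J : Ideal (𝓞 k), J.map (algebraMap (𝓞 k) (𝓞 K)) = I := by
  -- Noetherian induction: dividing out an extended prime leaves a strictly larger invariant ideal.
  induction I using WellFoundedGT.induction with
  | ind I ih =>
  by_cases htop : I = ⊤
  · exact ⟨⊤, by rw [htop, Ideal.map_top]⟩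
  obtain ⟨Q, hQmax, hQ⟩ := Ideal.exists_le_maximal I htop
  obtain ⟨I', hI'⟩ := h.map_under_dvd hI0 hI hQ
  set P := (Q.under (𝓞 k)).map (algebraMap (𝓞 k) (𝓞 K)) with hP
  have hP0 : P ≠ 0 := fun h0 ↦ hI0 (by rw [hI', h0, zero_mul]; rfl)
  have hI'0 : I' ≠ 0 := fun h0 ↦ hI0 (by rw [hI', h0, mul_zero]; rfl)
  have hPinv : ∀ σ : Gal(K/k), P.map (galRestrict (𝓞 k) k K (𝓞 K) σ) = P := by
    intro σ
    refine (Ideal.map_map (algebraMap (𝓞 k) (𝓞 K))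
      (galRestrict (𝓞 k) k K (𝓞 K) σ : 𝓞 K →+* 𝓞 K)).trans (congrArg (Ideal.map · _) ?_)
    exact RingHom.ext fun x ↦ (galRestrict (𝓞 k) k K (𝓞 K) σ).commutes x
  have hlt : I < I' := by
    refine lt_of_le_of_ne (hI' ▸ Ideal.mul_le_right) fun he ↦ ?_
    have h1 : P * I' = ⊤ * I' := by rw [← hI', Ideal.top_mul, he]
    have h2 : P = ⊤ := mul_right_cancel₀ hI'0 h1
    exact hQmax.ne_top (top_le_iff.mp (h2 ▸ Ideal.map_le_iff_le_comap.mpr le_rfl))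
  obtain ⟨J, hJ⟩ := ih I' hlt hI'0 fun σ ↦ by
    have h1 := hI σ
    rw [hI', Ideal.map_mul, hPinv] at h1
    exact mul_left_cancel₀ hP0 h1
  exact ⟨Q.under (𝓞 k) * J, by rw [Ideal.map_mul, hJ, hI']⟩

end InvariantIdeals

/-! ### Extension of fractional ideals and of their classes. -/

section Capitulation

open scoped nonZeroDivisors

theorem ClassGroup.mk_toPrincipalIdeal {R F : Type*} [CommRing R] [IsDomain R] [Field F]
    [Algebra R F] [IsFractionRing R F] (x : Fˣ) : ClassGroup.mk F (toPrincipalIdeal R F x) = 1 := by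
  rw [ClassGroup.mk_eq_one_iff, coe_toPrincipalIdeal, FractionalIdeal.coe_spanSingleton]
  exact ⟨_, rfl⟩

variable {k K : Type*} [Field k] [NumberField k] [Field K] [NumberField K] [Algebra k K]

/-- Extension of invertible fractional ideals from `k` to `K`. -/
noncomputable def extendIdeals (k K : Type*) [Field k] [NumberField k] [Field K]
    [NumberField K] [Algebra k K] :
    (FractionalIdeal (𝓞 k)⁰ k)ˣ →* (FractionalIdeal (𝓞 K)⁰ K)ˣ :=
  Units.map (FractionalIdeal.extendedHom K (𝓞 K)).toMonoidHom

theorem coe_extendIdeals (J : (FractionalIdeal (𝓞 k)⁰ k)ˣ) :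
    (extendIdeals k K J : FractionalIdeal (𝓞 K)⁰ K) =
      FractionalIdeal.extendedHom K (𝓞 K) (J : FractionalIdeal (𝓞 k)⁰ k) := rfl

theorem extendIdeals_toPrincipalIdeal (b : kˣ) :
    extendIdeals k K (toPrincipalIdeal (𝓞 k) k b) =
      toPrincipalIdeal (𝓞 K) K (Units.map (algebraMap k K : k →* K) b) := by
  ext1
  rw [coe_extendIdeals, coe_toPrincipalIdeal, coe_toPrincipalIdeal,
    FractionalIdeal.extendedHom_spanSingleton]
  congr 1
  exact RingHom.congr_fun (IsLocalization.algebraMap_eq_map_map_submonoid (𝓞 k)⁰ (𝓞 K) k K).symm _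

theorem extendIdeals_mk0 (I : (Ideal (𝓞 k))⁰) :
    extendIdeals k K (FractionalIdeal.mk0 k I) =
      FractionalIdeal.mk0 K (ClassGroup.extendedIdeal (𝓞 k) (𝓞 K) I) := by
  ext1
  rw [coe_extendIdeals, FractionalIdeal.coe_mk0, FractionalIdeal.coe_mk0,
    FractionalIdeal.extendedHom_coeIdeal_eq_map]

/-- Clearing a denominator of `J` changes it by a principal ideal, which reduces the claim to
integral ideals. -/
theorem classGroup_extendedHom_mk (J : (FractionalIdeal (𝓞 k)⁰ k)ˣ) :
    ClassGroup.extendedHom (𝓞 k) (𝓞 K) (ClassGroup.mk k J) = ClassGroup.mk K (extendIdeals k K J) := by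
  obtain ⟨a, I, ha, hJ⟩ := FractionalIdeal.exists_eq_spanSingleton_mul
    (J : FractionalIdeal (𝓞 k)⁰ k)
  have ha' : algebraMap (𝓞 k) k a ≠ 0 := by simpa using ha
  have hI : I ∈ (Ideal (𝓞 k))⁰ := by
    rw [mem_nonZeroDivisors_iff_ne_zero]
    rintro rfl
    exact J.ne_zero (by rw [hJ]; simp)
  have hJ' : J = toPrincipalIdeal (𝓞 k) k (Units.mk0 _ ha')⁻¹ * FractionalIdeal.mk0 k ⟨I, hI⟩ := by
    ext1
    rw [Units.val_mul, coe_toPrincipalIdeal, FractionalIdeal.coe_mk0, hJ]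
    simp
  rw [hJ', map_mul, map_mul, map_mul, extendIdeals_toPrincipalIdeal, map_mul, ClassGroup.mk_toPrincipalIdeal,
    ClassGroup.mk_toPrincipalIdeal, map_one, one_mul, one_mul, extendIdeals_mk0, ClassGroup.mk_mk0, ClassGroup.mk_mk0,
    ClassGroup.extendedHom_mk0]

end Capitulation

/-! ### Capitulation and units of norm one. -/

section Hilbert94

open scoped nonZeroDivisors

variable {k K : Type*} [Field k] [NumberField k] [Field K] [NumberField K] [Algebra k K]

/-- Pairs `(a, J)` of a generator `a` in `K` of the extension to `K` of a fractional ideal `J`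
of `k`. -/
noncomputable def capitulationPairs (k K : Type*) [Field k] [NumberField k] [Field K]
    [NumberField K] [Algebra k K] : Subgroup (Kˣ × (FractionalIdeal (𝓞 k)⁰ k)ˣ) :=
  ((toPrincipalIdeal (𝓞 K) K).comp (MonoidHom.fst _ _)).eqLocus
    ((extendIdeals k K).comp (MonoidHom.snd _ _))

theorem mem_capitulationPairs {x : Kˣ × (FractionalIdeal (𝓞 k)⁰ k)ˣ} :
    x ∈ capitulationPairs k K ↔ toPrincipalIdeal (𝓞 K) K x.1 = extendIdeals k K x.2 := Iff.rfl

/-- The class of `J` for a pair `(a, J)`. -/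
noncomputable def capitulationPairs.toClass (k K : Type*) [Field k] [NumberField k] [Field K]
    [NumberField K] [Algebra k K] : capitulationPairs k K →* ClassGroup (𝓞 k) :=
  (ClassGroup.mk k).comp ((MonoidHom.snd _ _).comp (capitulationPairs k K).subtype)

/-- The quotient `σ a / a` for a pair `(a, J)`. -/
noncomputable def capitulationPairs.toDiff (σ : Gal(K/k)) : capitulationPairs k K →* Kˣ :=
  (Units.map (σ : K →* K) / MonoidHom.id Kˣ).comp
    ((MonoidHom.fst _ _).comp (capitulationPairs k K).subtype)

theorem capitulationPairs.toDiff_apply (σ : Gal(K/k)) (x : capitulationPairs k K) :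
    (toDiff σ x : K) = σ (x.1.1 : K) / (x.1.1 : K) := by
  simp [toDiff]

theorem capitulationPairs.toClass_mem (x : capitulationPairs k K) :
    toClass k K x ∈ capitulationKernel k K := by
  have hx := mem_capitulationPairs.mp x.2
  change ClassGroup.extendedHom (𝓞 k) (𝓞 K) (ClassGroup.mk k x.1.2) = 1
  rw [classGroup_extendedHom_mk, ← hx, ClassGroup.mk_toPrincipalIdeal]

theorem exists_units_of_toPrincipalIdeal_eq {R F : Type*} [CommRing R] [IsDomain R] [Field F]
    [Algebra R F] [IsFractionRing R F] {x y : Fˣ}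
    (h : toPrincipalIdeal R F x = toPrincipalIdeal R F y) :
    ∃ u : Rˣ, Units.map (algebraMap R F : R →* F) u * x = y := by
  have h1 := congrArg Units.val h
  rw [coe_toPrincipalIdeal, coe_toPrincipalIdeal, ← FractionalIdeal.coeToSubmodule_inj,
    FractionalIdeal.coe_spanSingleton, FractionalIdeal.coe_spanSingleton,
    Submodule.span_singleton_eq_span_singleton] at h1
  obtain ⟨u, hu⟩ := h1
  exact ⟨u, Units.ext (by rw [← hu]; simp [Units.smul_def, Algebra.smul_def])⟩

/-- The embedding of the units of `𝓞 K` in `Kˣ`, written additively. -/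
noncomputable def unitsEmbedding (K : Type*) [Field K] : Additive (𝓞 K)ˣ →+ Additive Kˣ :=
  (Units.map (algebraMap (𝓞 K) K : 𝓞 K →* K)).toAdditive

theorem unitsEmbedding_injective {K : Type*} [Field K] : Function.Injective (unitsEmbedding K) :=
  Units.map_injective (FaithfulSMul.algebraMap_injective (𝓞 K) K)

/-- If `J = (b)` with `b` in `k`, the generator is `v * b` for a unit `v`, and `b` cancels from the
quotient because `σ` fixes it. -/
theorem capitulationPairs.toDiff_mem_of_toClass_eq_one (σ : Gal(K/k)) (x : capitulationPairs k K)
    (hx : toClass k K x = 1) :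
    Additive.ofMul (toDiff σ x) ∈
      (actionDiff (Additive (𝓞 K)ˣ) σ).range.map (unitsEmbedding K) := by
  have hx' : ClassGroup.mk k x.1.2 = 1 := hx
  obtain ⟨b, hb⟩ : ∃ b, toPrincipalIdeal (𝓞 k) k b = x.1.2 := by
    rw [ClassGroup.mk_eq_one_iff] at hx'
    obtain ⟨b, hb⟩ := hx'
    have hb' : ((x.1.2 : FractionalIdeal (𝓞 k)⁰ k)) = FractionalIdeal.spanSingleton _ b := by
      rw [← FractionalIdeal.coeToSubmodule_inj, FractionalIdeal.coe_spanSingleton, hb]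
    have hb0 : b ≠ 0 := by
      rintro rfl
      exact x.1.2.ne_zero (by rw [hb', FractionalIdeal.spanSingleton_zero])
    exact ⟨Units.mk0 b hb0, Units.ext (by rw [coe_toPrincipalIdeal, hb']; rfl)⟩
  have h1 := mem_capitulationPairs.mp x.2
  rw [← hb, extendIdeals_toPrincipalIdeal] at h1
  obtain ⟨v, hv⟩ := exists_units_of_toPrincipalIdeal_eq h1.symm
  refine ⟨_, ⟨Additive.ofMul v, rfl⟩, Additive.toMul.injective <| Units.ext ?_⟩
  have hσ : ((algebraMap (𝓞 K) K (((σ • Additive.ofMul v).toMul / v : (𝓞 K)ˣ) : 𝓞 K)) : K) =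
      σ (v : 𝓞 K) / (v : 𝓞 K) := by
    have := coe_toMul_smul σ (Additive.ofMul v)
    rw [eq_div_iff (by simp), ← map_mul, ← Units.val_mul, div_mul_cancel]
    exact this
  refine hσ.trans ?_
  rw [toMul_ofMul, toDiff_apply, ← hv]
  have hb0 : algebraMap k K b ≠ 0 := by simp
  change _ = σ ((v : 𝓞 K) * algebraMap k K b) / ((v : 𝓞 K) * algebraMap k K b)
  rw [map_mul, σ.commutes, mul_div_mul_right _ _ hb0]

theorem prod_galRestrict_pow_eq_one [IsGalois k K] {σ : Gal(K/k)}
    (hσ : ∀ τ, τ ∈ Subgroup.zpowers σ) {u : Additive (𝓞 K)ˣ}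
    (hu : actionNorm Gal(K/k) _ u = 0) :
    ∏ i ∈ Finset.range (orderOf σ), galRestrict (𝓞 k) k K (𝓞 K) (σ ^ i) (u.toMul : 𝓞 K) = 1 := by
  classical
  let f : Additive (𝓞 K)ˣ →+ Additive (𝓞 K) := (Units.coeHom (𝓞 K)).toAdditive
  have h := congrArg f hu
  rw [actionNorm_apply, map_sum, map_zero, ← IsCyclic.image_range_orderOf hσ, Finset.sum_image
    fun i hi j hj h ↦ pow_injOn_Iio_orderOf (by simpa using hi) (by simpa using hj) h] at h
  exact h

/-- Integral form of Hilbert's theorem 90 for units of relative norm one. -/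
theorem exists_mul_galRestrict_eq [IsGalois k K] {σ : Gal(K/k)}
    (hσ : ∀ τ, τ ∈ Subgroup.zpowers σ) {u : Additive (𝓞 K)ˣ}
    (hu : actionNorm Gal(K/k) _ u = 0) :
    ∃ ε : 𝓞 K, ε ≠ 0 ∧ (u.toMul : 𝓞 K) * galRestrict (𝓞 k) k K (𝓞 K) σ ε = ε := by
  set s := galRestrict (𝓞 k) k K (𝓞 K)
  set n := orderOf σ
  let c : ℕ → 𝓞 K := fun j ↦ ∏ i ∈ Finset.range j, s (σ ^ i) (u.toMul : 𝓞 K)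
  have hcn : c n = 1 := prod_galRestrict_pow_eq_one hσ hu
  have hcs : ∀ j, (u.toMul : 𝓞 K) * s σ (c j) = c (j + 1) := by
    intro j
    simp only [c, Finset.prod_range_succ' _ j, map_prod, pow_zero, map_one, AlgEquiv.one_apply,
      pow_succ', map_mul, AlgEquiv.mul_apply]
    rw [mul_comm]
  -- Lagrange resolvent with cocycle coefficients `c j`; taking `z` integral keeps it in `𝓞 K`.
  -- Since `c n = 1 = c 0`, applying `σ` and multiplying by `u` only shifts the sum cyclically.
  let ε : 𝓞 K → 𝓞 K := fun z ↦ ∑ j ∈ Finset.range n, c j * s (σ ^ j) z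
  have hε : ∀ z, (u.toMul : 𝓞 K) * s σ (ε z) = ε z := by
    intro z
    have h1 : (u.toMul : 𝓞 K) * s σ (ε z) =
        ∑ j ∈ Finset.range n, c (j + 1) * s (σ ^ (j + 1)) z := by
      simp only [ε, map_sum, Finset.mul_sum, ← hcs, pow_succ', map_mul, AlgEquiv.mul_apply,
        mul_assoc]
    have h2 := Finset.sum_range_succ' (fun j ↦ c j * s (σ ^ j) z) n
    rw [Finset.sum_range_succ, hcn, pow_orderOf_eq_one] at h2
    rw [h1]
    simpa [c, ε] using h2.symm
  by_contra! hcon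
  have h0 : ∀ z, ε z = 0 := fun z ↦ by
    by_contra h
    exact hcon _ h (hε z)
  let f : Fin n → (𝓞 K →* K) := fun j ↦
    (algebraMap (𝓞 K) K : 𝓞 K →* K).comp (s (σ ^ (j : ℕ)) : 𝓞 K →* 𝓞 K)
  have hf : Function.Injective f := by
    intro i j hij
    have h1 : s (σ ^ (i : ℕ)) = s (σ ^ (j : ℕ)) := AlgEquiv.ext fun z ↦
      FaithfulSMul.algebraMap_injective (𝓞 K) K (DFunLike.congr_fun hij z)
    exact Fin.ext (pow_injOn_Iio_orderOf i.2 j.2 (s.injective h1))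
  -- If every resolvent vanished, independence of characters would force `c 0 = 0`, but `c 0` is the
  -- empty product.
  have hli := (linearIndependent_monoidHom (𝓞 K) K).comp f hf
  have hpos : 0 < n := orderOf_pos σ
  have hc0 := Fintype.linearIndependent_iff.mp hli (fun j ↦ (c j : K)) (by
    ext z
    have h1 := congrArg (algebraMap (𝓞 K) K) (h0 z)
    simp only [ε, ← Fin.sum_univ_eq_sum_range (fun j ↦ c j * s (σ ^ j) z), map_sum, map_mul,
      map_zero] at h1
    rw [Finset.sum_apply]
    exact h1) ⟨0, hpos⟩
  simp [c] at hc0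

theorem IsUnramifiedAtFinitePlaces.mem_range_toDiff [IsGalois k K]
    (h : IsUnramifiedAtFinitePlaces k K) {σ : Gal(K/k)} (hσ : ∀ τ, τ ∈ Subgroup.zpowers σ)
    {u : Additive (𝓞 K)ˣ} (hu : actionNorm Gal(K/k) _ u = 0) :
    unitsEmbedding K u ∈ (capitulationPairs.toDiff σ).toAdditive.range := by
  -- The inverse unit is used so that `σ ε / ε` is `u` itself.
  have hu' : actionNorm Gal(K/k) _ (-u) = 0 := by rw [map_neg, hu, neg_zero]
  obtain ⟨ε, hε0, hε⟩ := exists_mul_galRestrict_eq hσ hu'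
  have hε' : galRestrict (𝓞 k) k K (𝓞 K) σ ε = u.toMul * ε := by
    conv_rhs => rw [← hε]
    rw [← mul_assoc, ← Units.val_mul, toMul_neg, mul_inv_cancel, Units.val_one, one_mul]
  have hinv : ∀ τ : Gal(K/k),
      (Ideal.span {ε}).map (galRestrict (𝓞 k) k K (𝓞 K) τ) = Ideal.span {ε} := by
    intro τ
    obtain ⟨j, rfl⟩ := mem_powers_iff_mem_zpowers.mpr (hσ τ)
    induction j with
    | zero => simp [Ideal.map_span]
    | succ j ih =>
      rw [Ideal.map_span, Set.image_singleton] at ih ⊢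
      simp only [pow_succ, map_mul, AlgEquiv.mul_apply, hε']
      rw [← Ideal.span_singleton_mul_span_singleton, ih,
        Ideal.span_singleton_eq_top.mpr ((u.toMul.isUnit).map _), Ideal.top_mul]
  have hspan0 : Ideal.span {ε} ≠ ⊥ := by simpa using hε0
  obtain ⟨J, hJ⟩ := h.exists_map_eq hspan0 hinv
  have hJ0 : J ∈ (Ideal (𝓞 k))⁰ := by
    rw [mem_nonZeroDivisors_iff_ne_zero]
    rintro rfl
    exact hspan0 (by rw [← hJ]; exact Ideal.map_bot)
  have hεK : (ε : K) ≠ 0 := by simpa using hε0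
  refine ⟨Additive.ofMul ⟨(Units.mk0 (ε : K) hεK, FractionalIdeal.mk0 k ⟨J, hJ0⟩), ?_⟩, ?_⟩
  · rw [mem_capitulationPairs, extendIdeals_mk0]
    ext1
    rw [coe_toPrincipalIdeal, FractionalIdeal.coe_mk0]
    simp [hJ, FractionalIdeal.coeIdeal_span_singleton]
  · refine Additive.toMul.injective <| Units.ext ?_
    refine (capitulationPairs.toDiff_apply σ _).trans ?_
    change σ (ε : K) / (ε : K) = ((u.toMul : 𝓞 K) : K)
    rw [← algebraMap_galRestrict_apply (𝓞 k) σ ε, hε', map_mul, mul_div_cancel_right₀ _ hεK]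

end Hilbert94

theorem mainTheorem9 (k K : Type*) [Field k] [NumberField k] [Field K] [NumberField K]
    [Algebra k K] [IsGalois k K] (hcyc : IsCyclic Gal(K/k))
    (hfin : IsUnramifiedAtFinitePlaces k K)
    (hinf : InfinitePlacesSplitCompletely k K) :
    Module.finrank k K ∣ Nat.card (capitulationKernel k K) := by
  obtain ⟨σ, hσ⟩ := hcyc.exists_generator
  set E := Additive (𝓞 K)ˣ
  set D := (actionDiff E σ).range.map (unitsEmbedding K)
  set U := (actionNorm Gal(K/k) E).ker.map (unitsEmbedding K)
  set ψ := (capitulationPairs.toDiff σ).toAdditive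
  set φ := (capitulationPairs.toClass k K).toAdditive
  have hDU : D ≤ U := by
    apply AddSubgroup.map_mono
    rintro _ ⟨v, rfl⟩
    exact actionNorm_actionDiff σ v
  have hU : U ≤ ψ.range := by
    rintro _ ⟨u, hu, rfl⟩
    exact hfin.mem_range_toDiff hσ hu
  have hker : φ.ker ≤ D.comap ψ := fun x hx ↦
    capitulationPairs.toDiff_mem_of_toClass_eq_one σ x.toMul hx
  have hrange : φ.range ≤ (capitulationKernel k K).toAddSubgroup := by
    rintro _ ⟨x, rfl⟩
    exact capitulationPairs.toClass_mem x.toMul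
  calc Module.finrank k K ∣ (actionDiff E σ).range.relIndex (actionNorm Gal(K/k) E).ker :=
        Dvd.intro _ (units_relIndex_eq hinf hσ).symm
    _ = D.relIndex U :=
        (AddSubgroup.relIndex_map_map_of_injective _ _ unitsEmbedding_injective).symm
    -- Only the inclusion of `U` in the range of `ψ` is needed, since enlarging the group multiplies
    -- the index.
    _ ∣ D.relIndex ψ.range := Dvd.intro _ (AddSubgroup.relIndex_mul_relIndex _ _ _ hDU hU)
    _ = (D.comap ψ).index := (AddSubgroup.index_comap D ψ).symm
    _ ∣ φ.ker.index := AddSubgroup.index_dvd_of_le hker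
    _ = Nat.card φ.range := AddSubgroup.index_ker φ
    _ ∣ Nat.card (capitulationKernel k K).toAddSubgroup := AddSubgroup.card_dvd_of_le hrange
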